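/- **Setting.** A $u$-uniform hypergraph on $n$ vertices has a set of hyperedges, each a set of $u$ vertices. A $k$-hyperclique is a set of $k$ vertices all of whose $u$-element subsets are hyperedges. A (tight) $k$-hypercycle is a list of $k$ distinct vertices $v_0,\dots,v_{k-1}$ such that $\{v_i,v_{i+1},\dots,v_{i+u-1}\}$ (indices modulo $k$) is a hyperedge for every $i$. An algorithm is a fixed (deterministic) program on a Word-RAM with $O(\log n)$-bit words, where $n$ is the number of vertices; the input is $n$ together with the $n^u$-entry adjacency tensor of the hypergraph. A problem *requires $n^{k-o(1)}$ time* if for no $\varepsilon>0$ is there an algorithm that solves it in time $O(n^{k-\varepsilon})$. The $(3,k)$-hyperclique hypothesis says that deciding whether a $3$-uniform hypergraph on $n$ vertices has a $k$-hyperclique requires $n^{k-o(1)}$ time. Let $\gamma_3(k)=k-\lceil k/3\rceil+1$, and let $\gamma_3^{-1}(u)$ be the largest $k$ with $\gamma_3(k)=u$. **Theorem.** Let $u\ge 1$ and let $k$ be an integer with $u\le k\le\gamma_3^{-1}(u)$. Assume the $(3,k)$-hyperclique hypothesis. Then each of the following problems on $u$-uniform hypergraphs with $n$ vertices requires $n^{k-o(1)}$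 time: deciding whether there is a $k$-hypercycle; finding a $k$-hypercycle or reporting that there is none; counting the $k$-hypercycles. -/

import Mathlib

open Filter Asymptotics

/-! ### The word RAM -/

namespace WordRAM

/-- The arithmetic and bitwise operations that a word RAM performs in one step.
Subtraction is truncated at `0`, and division by `0` gives `0`. -/
inductive BinOp where
  | add | sub | mul | div | mod | band | bor | bxor | shl | shr

/-- The value of an operation, before it is checked that the result fits in a word. -/
def BinOp.eval : BinOp → ℕ → ℕ → ℕ
  | .add, x, y => x + y
  | .sub, x, y => x - y
  | .mul, x, y => x * y
  | .div, x, y => x / y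
  | .mod, x, y => x % y
  | .band, x, y => x &&& y
  | .bor, x, y => x ||| y
  | .bxor, x, y => x ^^^ y
  | .shl, x, y => x <<< y
  | .shr, x, y => x >>> y

/-- Instructions. Registers and positions in the program are named by natural numbers that are
part of the program text; memory is addressed indirectly, through registers. -/
inductive Instr where
  /-- `reg d := x` -/
  | const (d x : ℕ)
  /-- `reg d := reg a ∘ reg b` -/
  | op (o : BinOp) (d a b : ℕ)
  /-- `reg d := mem (reg a)` -/
  | load (d a : ℕ)
  /-- `mem (reg a) := reg s` -/
  | store (a s : ℕ)
  /-- go to position `l` -/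
  | jump (l : ℕ)
  /-- go to position `l` if `reg a < reg b` -/
  | jumpLt (a b l : ℕ)
  /-- go to position `l` if `reg a = reg b` -/
  | jumpEq (a b l : ℕ)
  /-- stop -/
  | halt

/-- A program is a finite list of instructions; it does not depend on the input. -/
abbrev Program := List Instr

/-- A configuration: program counter, registers, memory. -/
structure Config where
  pc : ℕ
  reg : ℕ → ℕ
  mem : ℕ → ℕ

/-- Write `x` to register `d` and proceed to the next instruction; this is a fault if `x` does not
fit in a word of `W` bits. -/
def Config.write (W : ℕ) (s : Config) (d x : ℕ) : Option Config :=
  if x < 2 ^ W then some ⟨s.pc + 1, Function.update s.reg d x, s.mem⟩ else none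

/-- One step of the machine with words of `W` bits. The value is `none` if the machine has
halted, if a result does not fit in a word, or if the program counter is outside the program. -/
def step (W : ℕ) (P : Program) (s : Config) : Option Config :=
  match P[s.pc]? with
  | none => none
  | some (.const d x) => s.write W d x
  | some (.op o d a b) => s.write W d (o.eval (s.reg a) (s.reg b))
  | some (.load d a) => s.write W d (s.mem (s.reg a))
  | some (.store a r) => some ⟨s.pc + 1, s.reg, Function.update s.mem (s.reg a) (s.reg r)⟩
  | some (.jump l) => some ⟨l, s.reg, s.mem⟩
  | some (.jumpLt a b l) => some ⟨if s.reg a < s.reg b then l else s.pc + 1, s.reg, s.mem⟩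
  | some (.jumpEq a b l) => some ⟨if s.reg a = s.reg b then l else s.pc + 1, s.reg, s.mem⟩
  | some .halt => none

/-- The configuration after exactly `t` steps, if all of them can be performed. -/
def run (W : ℕ) (P : Program) : ℕ → Config → Option Config
  | 0, s => some s
  | t + 1, s => (step W P s).bind (run W P t)

/-- Started in `s`, the machine with words of `W` bits executes exactly `t` steps without a fault
and then stands at a `halt` instruction, in configuration `s'`. -/
def HaltsIn (W : ℕ) (P : Program) (s : Config) (t : ℕ) (s' : Config) : Prop :=
  run W P t s = some s' ∧ P[s'.pc]? = some .halt

end WordRAM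

/-! ### Hypergraphs, hypercliques and hypercycles -/

/-- A `u`-uniform hypergraph with vertex set `Fin n`. -/
structure UniformHypergraph (u n : ℕ) where
  edges : Finset (Finset (Fin n))
  card_eq : ∀ e ∈ edges, e.card = u

namespace UniformHypergraph

variable {u n : ℕ}

/-- `S` is a `k`-hyperclique of `G`: it has `k` vertices and all its `u`-subsets are hyperedges. -/
def IsHyperclique (G : UniformHypergraph u n) (k : ℕ) (S : Finset (Fin n)) : Prop :=
  S.card = k ∧ ∀ e ⊆ S, e.card = u → e ∈ G.edges

/-- The list `v` of `k` distinct vertices is a (tight) `k`-hypercycle of `G`: any `u` cyclically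
consecutive vertices `v i, v (i + 1), …, v (i + u - 1)` form a hyperedge. -/
def IsHypercycle (G : UniformHypergraph u n) (k : ℕ) (v : Fin k → Fin n) : Prop :=
  Function.Injective v ∧
    ∀ i : Fin k, (Finset.range u).image (fun j => v ⟨((i : ℕ) + j) % k, Nat.mod_lt _ i.pos⟩) ∈ G.edges

open Classical in
/-- The memory that presents `G` to a machine: its adjacency tensor. The cell with address
`v 0 + v 1 * n + ⋯ + v (u - 1) * n ^ (u - 1)` holds `1` if `{v 0, …, v (u - 1)}` is a hyperedge;
every other cell holds `0`. -/
noncomputable def tensor (G : UniformHypergraph u n) (a : ℕ) : ℕ :=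
  if ∃ v : Fin u → Fin n, a = ∑ i, (v i : ℕ) * n ^ (i : ℕ) ∧ Finset.univ.image v ∈ G.edges
  then 1 else 0

/-- The configuration in which a machine is started on the input `G`: the number of vertices is in
register `0`, the other registers are `0`, and the adjacency tensor is in memory. -/
noncomputable def startConfig (G : UniformHypergraph u n) : WordRAM.Config :=
  ⟨0, fun r => if r = 0 then n else 0, G.tensor⟩

end UniformHypergraph

/-! ### Problems on hypergraphs and their complexity -/

/-- A computational problem on `u`-uniform hypergraphs: which contents of the registers are a
correct output on which input. -/
abbrev HypergraphProblem (u : ℕ) := ∀ n : ℕ, UniformHypergraph u n → (ℕ → ℕ) → Prop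

/-- Decide whether there is a `k`-hyperclique: register `0` is nonzero iff there is one. -/
def detectHyperclique (u k : ℕ) : HypergraphProblem u := fun _ G out =>
  out 0 ≠ 0 ↔ ∃ S, G.IsHyperclique k S

/-- Decide whether there is a `k`-hypercycle: register `0` is nonzero iff there is one. -/
def detectHypercycle (u k : ℕ) : HypergraphProblem u := fun _ G out =>
  out 0 ≠ 0 ↔ ∃ v, G.IsHypercycle k v

/-- Find a `k`-hypercycle: register `0` is nonzero and registers `1, …, k` list the vertices of a
`k`-hypercycle, or register `0` is zero and there is no `k`-hypercycle. -/
def findHypercycle (u k : ℕ) : HypergraphProblem u := fun _ G out =>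
  (out 0 ≠ 0 ∧ ∃ v, G.IsHypercycle k v ∧ ∀ i : Fin k, out ((i : ℕ) + 1) = (v i : ℕ)) ∨
    (out 0 = 0 ∧ ¬ ∃ v, G.IsHypercycle k v)

/-- Count the `k`-hypercycles (as lists of vertices): register `0` is their number. -/
def countHypercycles (u k : ℕ) : HypergraphProblem u := fun _ G out =>
  out 0 = Nat.card {v : Fin k → Fin _ // G.IsHypercycle k v}

/-- The program `P`, run on a word RAM whose words have `O(log n)` bits, solves the problem `R` on
all hypergraphs, within `T n` steps on those with `n` vertices. -/
def SolvesInTime {u : ℕ} (R : HypergraphProblem u) (P : WordRAM.Program) (T : ℕ → ℕ) : Prop :=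
  ∃ c : ℕ, 0 < c ∧ ∀ (n : ℕ) (G : UniformHypergraph u n), ∃ t ≤ T n, ∃ s : WordRAM.Config,
    WordRAM.HaltsIn (c * (Nat.log 2 n + 1)) P G.startConfig t s ∧ R n G s.reg

/-- The problem `R` requires `n ^ (k - o(1))` time: for no `ε > 0` is there a program that solves
it in time `O(n ^ (k - ε))`. -/
def RequiresTimePow {u : ℕ} (R : HypergraphProblem u) (k : ℕ) : Prop :=
  ∀ ε : ℝ, 0 < ε → ¬ ∃ (P : WordRAM.Program) (T : ℕ → ℕ),
    (fun n : ℕ => (T n : ℝ)) =O[atTop] (fun n : ℕ => (n : ℝ) ^ ((k : ℝ) - ε)) ∧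
      SolvesInTime R P T

/-- The `(u, k)`-hyperclique hypothesis (made for `k > u > 2`). -/
def HypercliqueHypothesis (u k : ℕ) : Prop :=
  RequiresTimePow (detectHyperclique u k) k

/-! ### The range of cycle lengths -/

/-- `γ_c(k) = k - ⌈k / c⌉ + 1`. -/
def gamma (c k : ℕ) : ℕ := k - ⌈(k : ℚ) / c⌉₊ + 1

/-- `γ_c⁻¹(u)`, the largest `k` with `γ_c(k) = u`. -/
noncomputable def gammaInv (c u : ℕ) : ℕ := sSup {k | gamma c k = u}

/-- The maximum in the definition of `γ₃⁻¹(u)` is attained. -/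
theorem gammaInv_isGreatest (u : ℕ) (hu : 0 < u) :
    IsGreatest {k | gamma 3 k = u} (gammaInv 3 u) := by
  have key : ∀ k, gamma 3 k = k - (k + 2) / 3 + 1 := by
    intro k
    have h : ⌈(k : ℚ) / (3 : ℕ)⌉₊ = (k + 2) / 3 := by
      apply le_antisymm
      · rw [Nat.ceil_le, div_le_iff₀ (by norm_num)]
        have : k ≤ (k + 2) / 3 * 3 := by omega
        exact_mod_cast this
      · have h1 : (k : ℚ) ≤ ⌈(k : ℚ) / (3 : ℕ)⌉₊ * (3 : ℕ) :=
          (div_le_iff₀ (by norm_num)).1 (Nat.le_ceil _)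
        have h2 : k ≤ ⌈(k : ℚ) / (3 : ℕ)⌉₊ * 3 := by exact_mod_cast h1
        omega
    unfold gamma
    rw [h]
  have hg : IsGreatest {k | gamma 3 k = u} (u + (u - 1) / 2) := by
    constructor
    · rw [Set.mem_ofPred_eq, key]; omega
    · intro k hk
      rw [Set.mem_ofPred_eq, key] at hk
      omega
  have : gammaInv 3 u = u + (u - 1) / 2 := hg.csSup_eq
  rw [this]
  exact hg

/-! Two arguments are combined, according to whether `u < k` or `u = k`. In both, the range of `k`
enters only through `2 * k < 3 * u` (`two_mul_lt_of_le_gammaInv`).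

If `u < k`, hyperclique detection reduces to hypercycle detection. Given a `3`-uniform `G`, take as
hyperedges the `u`-sets that are hypercliques of `G`. Any ordering of a `k`-hyperclique is then a
hypercycle. Conversely, three positions on a cycle of length `k` cut it into three arcs, one of
length at least `k / 3`; the complement of the interior of that arc fits into `u` consecutive
positions (`exists_window`). So every triple of vertices of a hypercycle lies in a hyperedge, which
is a hyperclique of `G`, and the vertices of the hypercycle form a `k`-hyperclique
(`exists_isHypercycle_cliqueHypergraph_iff`). The new tensor is computed on the word RAM in `O(n ^
u)` steps (`run_preprocess`), which is negligible against `n ^ (k - ε)` for `ε ≤ 1`.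

If `u = k`, writing the new tensor already costs `n ^ k`, so the reduction proves nothing. The bound
is then unconditional: a hypercycle is a single hyperedge, and on the empty hypergraph a correct
program must read a cell for each of the `n.choose k` possible hyperedges
(`SolvesInTime.choose_le`).

Finding and counting are at least as hard as deciding, since register `0` of a correct output
already answers the decision problem. -/

/-! ### Addresses of the adjacency tensor -/

namespace UniformHypergraph

variable {u n : ℕ}

/-- The vertex tuple that the address of a cell of the adjacency tensor encodes. -/
def tupleAt (a : Fin (n ^ u)) : Fin u → Fin n := finFunctionFinEquiv.symm a

theorem sum_tupleAt (a : Fin (n ^ u)) : ∑ i, (tupleAt a i : ℕ) * n ^ (i : ℕ) = a := by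
  rw [← finFunctionFinEquiv_apply, tupleAt, Equiv.apply_symm_apply]

theorem eq_tupleAt {a : Fin (n ^ u)} {v : Fin u → Fin n}
    (h : (a : ℕ) = ∑ i, (v i : ℕ) * n ^ (i : ℕ)) : v = tupleAt a := by
  rw [tupleAt, Equiv.eq_symm_apply]
  apply Fin.ext
  rw [finFunctionFinEquiv_apply, h]

theorem sum_lt_pow (v : Fin u → Fin n) : ∑ i, (v i : ℕ) * n ^ (i : ℕ) < n ^ u := by
  rw [← finFunctionFinEquiv_apply]
  exact (finFunctionFinEquiv v).isLt

-- Base `n` expansions with `u` digits are unique, so only one tuple can witness the existential in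
-- `tensor`.
open Classical in
theorem tensor_of_lt (G : UniformHypergraph u n) {a : ℕ} (h : a < n ^ u) :
    G.tensor a = if Finset.univ.image (tupleAt ⟨a, h⟩) ∈ G.edges then 1 else 0 := by
  unfold tensor
  congr 1
  apply propext
  constructor
  · rintro ⟨v, hv, he⟩
    rwa [eq_tupleAt (a := ⟨a, h⟩) hv] at he
  · intro he
    exact ⟨_, (sum_tupleAt ⟨a, h⟩).symm, he⟩

theorem tensor_of_le (G : UniformHypergraph u n) {a : ℕ} (h : n ^ u ≤ a) : G.tensor a = 0 := by
  unfold tensor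
  rw [if_neg]
  rintro ⟨v, hv, -⟩
  have := sum_lt_pow v
  omega

open Classical in
theorem tensor_three (G : UniformHypergraph 3 n) (x y z : Fin n) :
    G.tensor (((z : ℕ) * n + y) * n + x) = if {x, y, z} ∈ G.edges then 1 else 0 := by
  have hs : ((z : ℕ) * n + y) * n + x = ∑ i, (![x, y, z] i : ℕ) * n ^ (i : ℕ) := by
    simp [Fin.sum_univ_three]; ring
  have hi : Finset.univ.image ![x, y, z] = {x, y, z} := by
    ext w; simp [Fin.exists_fin_succ, eq_comm]
  have hlt := sum_lt_pow ![x, y, z]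
  rw [← hs] at hlt
  rw [tensor_of_lt G hlt, ← eq_tupleAt (a := ⟨_, hlt⟩) hs, hi]

/-! ### Hypercycles in the hypergraph of cliques -/

open Classical in
/-- The `u`-uniform hypergraph whose hyperedges are the `u`-hypercliques of `G`. -/
noncomputable def cliqueHypergraph (G : UniformHypergraph 3 n) (u : ℕ) : UniformHypergraph u n where
  edges := Finset.univ.filter (G.IsHyperclique u)
  card_eq e he := by
    rw [Finset.mem_filter] at he
    exact he.2.1

theorem mem_cliqueHypergraph {G : UniformHypergraph 3 n} {e : Finset (Fin n)} :
    e ∈ (G.cliqueHypergraph u).edges ↔ G.IsHyperclique u e := by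
  simp [cliqueHypergraph]

/-- If the window of length `u` that starts at one of the three points misses another, then the arc
ending at that start has length at most `k - u`. If this happened at all three starts, the arcs
would give `k ≤ 3 * (k - u)`, against `h`. -/
theorem exists_window {k : ℕ} (h : 2 * k < 3 * u) (a b c : Fin k) :
    ∃ i : Fin k, ∀ x : Fin k, x = a ∨ x = b ∨ x = c →
      ∃ j < u, ((i : ℕ) + j) % k = x := by
  -- Membership in a cyclic window without `%`, split by whether the window wraps around before
  -- reaching `x`; this makes the problem linear.
  have key : ∀ i x : Fin k, ((i : ℕ) ≤ x ∧ (x : ℕ) < u + i) ∨ ((x : ℕ) < i ∧ x + k < u + i) →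
      ∃ j < u, ((i : ℕ) + j) % k = x := by
    rintro i x (⟨h1, h2⟩ | ⟨h1, h2⟩)
    · refine ⟨x - i, by omega, ?_⟩
      rw [Nat.add_sub_cancel' h1, Nat.mod_eq_of_lt x.isLt]
    · refine ⟨x + k - i, by omega, ?_⟩
      rw [Nat.add_sub_cancel' (by omega), Nat.add_mod_right, Nat.mod_eq_of_lt x.isLt]
  have ha := a.isLt
  have hb := b.isLt
  have hc := c.isLt
  by_contra! hcon
  have aux : ∀ i : Fin k, ∃ x : Fin k, (x = a ∨ x = b ∨ x = c) ∧
      ¬ (((i : ℕ) ≤ x ∧ (x : ℕ) < u + i) ∨ ((x : ℕ) < i ∧ x + k < u + i)) := by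
    intro i
    obtain ⟨x, hx, hx'⟩ := hcon i
    refine ⟨x, hx, fun hw => ?_⟩
    obtain ⟨j, hj, hj'⟩ := key i x hw
    exact hx' j hj hj'
  obtain ⟨x, hx, hxn⟩ := aux a
  obtain ⟨y, hy, hyn⟩ := aux b
  obtain ⟨z, hz, hzn⟩ := aux c
  rcases hx with rfl | rfl | rfl <;> rcases hy with rfl | rfl | rfl <;>
    rcases hz with rfl | rfl | rfl <;> omega

theorem card_window {k : ℕ} (huk : u ≤ k) {v : Fin k → Fin n} (hv : Function.Injective v)
    (i : Fin k) : ((Finset.range u).image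
      (fun j => v ⟨((i : ℕ) + j) % k, Nat.mod_lt _ i.pos⟩)).card = u := by
  rw [Finset.card_image_of_injOn, Finset.card_range]
  intro j hj j' hj' hjj
  have h1 := congrArg Fin.val (hv hjj)
  simp only [Finset.coe_range, Set.mem_Iio] at hj hj'
  exact Nat.ModEq.eq_of_lt_of_lt (Nat.ModEq.add_left_cancel' (i : ℕ) h1)
    (by omega) (by omega)

/-- Left to right, each triple of cycle vertices shares a window, and that window is a hyperclique.
Right to left, any enumeration of the hyperclique works; the increasing one is used. -/
theorem exists_isHypercycle_cliqueHypergraph_iff (G : UniformHypergraph 3 n) {k : ℕ}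
    (huk : u ≤ k) (h : 2 * k < 3 * u) :
    (∃ v, (G.cliqueHypergraph u).IsHypercycle k v) ↔ ∃ S, G.IsHyperclique k S := by
  constructor
  · rintro ⟨v, hv, hw⟩
    refine ⟨Finset.univ.image v, by simp [Finset.card_image_of_injective _ hv], fun f hf hf3 => ?_⟩
    obtain ⟨x, y, z, -, -, -, rfl⟩ := Finset.card_eq_three.1 hf3
    obtain ⟨a, -, rfl⟩ := Finset.mem_image.1 (hf (by simp : x ∈ _))
    obtain ⟨b, -, rfl⟩ := Finset.mem_image.1 (hf (by simp : y ∈ _))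
    obtain ⟨c, -, rfl⟩ := Finset.mem_image.1 (hf (by simp : z ∈ _))
    obtain ⟨i, hi⟩ := exists_window h a b c
    refine (mem_cliqueHypergraph.1 (hw i)).2 _ ?_ hf3
    have key : ∀ x : Fin k, x = a ∨ x = b ∨ x = c → v x ∈ (Finset.range u).image
        (fun j => v ⟨((i : ℕ) + j) % k, Nat.mod_lt _ i.pos⟩) := by
      intro x hx
      obtain ⟨j, hj, hjx⟩ := hi x hx
      exact Finset.mem_image.2 ⟨j, Finset.mem_range.2 hj, congrArg v (Fin.ext hjx)⟩
    intro w hw'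
    simp only [Finset.mem_insert, Finset.mem_singleton] at hw'
    rcases hw' with rfl | rfl | rfl
    · exact key _ (by simp)
    · exact key _ (by simp)
    · exact key _ (by simp)
  · rintro ⟨S, hS, hc⟩
    refine ⟨S.orderEmbOfFin hS, (S.orderEmbOfFin hS).injective, fun i => ?_⟩
    refine mem_cliqueHypergraph.2 ⟨?_, fun e he => hc e (he.trans ?_)⟩
    · exact card_window huk (S.orderEmbOfFin hS).injective i
    · intro w hw
      obtain ⟨j, -, rfl⟩ := Finset.mem_image.1 hw
      exact S.orderEmbOfFin_mem hS _

/-! ### The adjacency tensor of the hypergraph of cliques -/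

/-- The increasing triples of indices below `u`. -/
noncomputable def triples (u : ℕ) : List (ℕ × ℕ × ℕ) :=
  ((Finset.range u ×ˢ Finset.range u ×ˢ Finset.range u).filter
    fun t => t.1 < t.2.1 ∧ t.2.1 < t.2.2).toList

theorem mem_triples {t : ℕ × ℕ × ℕ} : t ∈ triples u ↔ t.1 < t.2.1 ∧ t.2.1 < t.2.2 ∧ t.2.2 < u := by
  simp only [triples, Finset.mem_toList, Finset.mem_filter, Finset.mem_product, Finset.mem_range]
  omega

/-- The `i`-th base `n` digit of `a`. -/
def digit (n a i : ℕ) : ℕ := a / n ^ i % n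

/-- The address in a `3`-dimensional tensor of the subtuple at positions `t` of the tuple at `a`. -/
def subaddress (n a : ℕ) (t : ℕ × ℕ × ℕ) : ℕ :=
  (digit n a t.2.2 * n + digit n a t.2.1) * n + digit n a t.1

/-- Distinctness of the vertices needs no separate test: a hyperedge of `G` has three distinct
vertices, and since `3 ≤ u` any two positions belong to an increasing triple. -/
theorem isHyperclique_image_iff (G : UniformHypergraph 3 n) (hu : 3 ≤ u) (v : Fin u → Fin n) :
    G.IsHyperclique u (Finset.univ.image v) ↔
      ∀ a b c : Fin u, a < b → b < c → ({v a, v b, v c} : Finset (Fin n)) ∈ G.edges := by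
  constructor
  · rintro ⟨hc, h⟩ a b c hab hbc
    have hv : Function.Injective v := by
      rw [← Set.injOn_univ, ← Finset.coe_univ]
      exact Finset.card_image_iff.1 (by simpa using hc)
    refine h _ ?_ ?_
    · intro w; simp; rintro (rfl | rfl | rfl) <;> simp
    · exact Finset.card_eq_three.2 ⟨_, _, _, hv.ne hab.ne, hv.ne (hab.trans hbc).ne,
        hv.ne hbc.ne, rfl⟩
  · intro h
    have hcard : ∀ a b c : Fin u, a < b → b < c →
        v a ≠ v b ∧ v a ≠ v c ∧ v b ≠ v c := by
      intro a b c hab hbc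
      have h3 := G.card_eq _ (h a b c hab hbc)
      refine ⟨fun he => ?_, fun he => ?_, fun he => ?_⟩ <;>
      · have h4 := Finset.card_le_two (a := v a) (b := v b)
        have h5 := Finset.card_le_two (a := v b) (b := v c)
        simp [he] at h3 h4 h5
        omega
    have hne : ∀ a b : Fin u, a < b → v a ≠ v b := by
      intro a b hab
      -- The third position is `0` if `0 < a`, `2` if the pair is `(0, 1)`, and otherwise `1`,
      -- between `a = 0` and `b`.
      by_cases h0 : 0 < (a : ℕ)
      · exact (hcard ⟨0, by omega⟩ a b h0 hab).2.2
      · by_cases hb : (b : ℕ) = 1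
        · exact (hcard a b ⟨2, by omega⟩ hab (by rw [Fin.lt_def]; simp [hb])).1
        · exact (hcard a ⟨1, by omega⟩ b (by rw [Fin.lt_def]; simp; omega)
            (by rw [Fin.lt_def] at hab ⊢; simp; omega)).2.1
    have hv : Function.Injective v := by
      intro a b hab
      rcases lt_trichotomy a b with hlt | heq | hgt
      · exact absurd hab (hne a b hlt)
      · exact heq
      · exact absurd hab.symm (hne b a hgt)
    refine ⟨by simp [Finset.card_image_of_injective _ hv], fun f hf hf3 => ?_⟩
    obtain ⟨g, rfl⟩ : ∃ g : Finset (Fin u), g.image v = f := by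
      obtain ⟨g, -, hg⟩ := Finset.subset_image_iff.1 hf
      exact ⟨g, hg⟩
    rw [Finset.card_image_of_injective _ hv] at hf3
    have := h (g.orderEmbOfFin hf3 0) (g.orderEmbOfFin hf3 1) (g.orderEmbOfFin hf3 2)
      (by simp) (by simp)
    convert this using 1
    have hg : ∀ x, x ∈ g ↔ ∃ i, g.orderEmbOfFin hf3 i = x := by
      intro x
      rw [← Finset.mem_coe, ← Finset.range_orderEmbOfFin g hf3, Set.mem_range]
    ext w
    simp only [Finset.mem_image, hg, Fin.exists_fin_succ]
    simp [eq_comm]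

/-- The entries are `0` or `1`, so their product is the conjunction of the tests; the program can
multiply instead of branching. -/
theorem prod_tensor_subaddress (G : UniformHypergraph 3 n) (hu : 3 ≤ u) {a : ℕ} (ha : a < n ^ u) :
    ((triples u).map fun t => G.tensor (subaddress n a t)).prod =
      (G.cliqueHypergraph u).tensor a := by
  classical
  have hd : ∀ i : Fin u, digit n a i = tupleAt ⟨a, ha⟩ i := fun i => rfl
  have hval : ∀ x y z : Fin u, G.tensor (subaddress n a (x, y, z)) =
      if {tupleAt ⟨a, ha⟩ x, tupleAt ⟨a, ha⟩ y, tupleAt ⟨a, ha⟩ z} ∈ G.edges then 1 else 0 := by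
    intro x y z
    rw [← tensor_three]
    simp only [subaddress, hd]
  rw [tensor_of_lt _ ha]
  simp only [mem_cliqueHypergraph, isHyperclique_image_iff G hu]
  split_ifs with hc
  · apply List.prod_eq_one
    intro x hx
    obtain ⟨⟨i, j, l⟩, ht, rfl⟩ := List.mem_map.1 hx
    obtain ⟨h1, h2, h3⟩ := mem_triples.1 ht
    simp only at h1 h2 h3
    rw [hval ⟨i, by omega⟩ ⟨j, by omega⟩ ⟨l, h3⟩, if_pos (hc _ _ _ h1 h2)]
  · push Not at hc
    obtain ⟨x, y, z, hxy, hyz, hn⟩ := hc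
    apply List.prod_eq_zero
    refine List.mem_map.2 ⟨(x, y, z), mem_triples.2 ⟨hxy, hyz, z.isLt⟩, ?_⟩
    rw [hval, if_neg hn]

theorem subaddress_lt {a : ℕ} (hn : 0 < n) (t : ℕ × ℕ × ℕ) : subaddress n a t < n ^ 3 := by
  have h : ∀ i, digit n a i + 1 ≤ n := fun i => Nat.mod_lt _ hn
  have h1 := h t.1
  have h2 := Nat.mul_le_mul_right n (h t.2.1)
  have h3 := Nat.mul_le_mul_right (n ^ 2) (h t.2.2)
  unfold subaddress
  nlinarith

end UniformHypergraph

/-! ### Running pieces of programs -/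

namespace WordRAM

theorem run_add (W : ℕ) (P : Program) (t t' : ℕ) (s : Config) :
    run W P (t + t') s = (run W P t s).bind (run W P t') := by
  induction t generalizing s with
  | zero => simp [run]
  | succ t ih =>
    rw [Nat.succ_add]
    simp only [run, Option.bind_assoc]
    congr 1
    funext x
    exact ih x

theorem run_trans {W : ℕ} {P : Program} {t t' : ℕ} {s s' s'' : Config}
    (h : run W P t s = some s') (h' : run W P t' s' = some s'') :
    run W P (t + t') s = some s'' := by
  rw [run_add, h, Option.bind_some, h']

theorem run_one (W : ℕ) (P : Program) (s : Config) : run W P 1 s = step W P s := by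
  simp [run]

/-- The code `B` occurs in the program `P` at position `p`. -/
def HasCode (P : Program) (p : ℕ) (B : List Instr) : Prop := B <+: P.drop p

theorem HasCode.left {P : Program} {p : ℕ} {A B : List Instr} (h : HasCode P p (A ++ B)) :
    HasCode P p A := (List.prefix_append A B).trans h

theorem HasCode.right {P : Program} {p : ℕ} {A B : List Instr} (h : HasCode P p (A ++ B)) :
    HasCode P (p + A.length) B := by
  obtain ⟨C, hC⟩ := h
  refine ⟨C, ?_⟩
  rw [← List.drop_drop, ← hC, List.append_assoc, List.drop_left]

theorem HasCode.head {P : Program} {p : ℕ} {i : Instr} {B : List Instr} (h : HasCode P p (i :: B)) :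
    P[p]? = some i := by
  obtain ⟨C, hC⟩ := h
  have := congrArg (fun l => l[0]?) hC
  simpa using this.symm

theorem HasCode.tail {P : Program} {p : ℕ} {i : Instr} {B : List Instr} (h : HasCode P p (i :: B)) :
    HasCode P (p + 1) B := HasCode.right (A := [i]) h

/-- The effect of an instruction that is not a jump. -/
def Instr.exec (W : ℕ) : Instr → Config → Option Config
  | .const d x, s => s.write W d x
  | .op o d a b, s => s.write W d (o.eval (s.reg a) (s.reg b))
  | .load d a, s => s.write W d (s.mem (s.reg a))
  | .store a r, s => some ⟨s.pc + 1, s.reg, Function.update s.mem (s.reg a) (s.reg r)⟩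
  | _, _ => none

theorem Instr.step_of_exec {W : ℕ} {P : Program} {i : Instr} {s s' : Config}
    (h : i.exec W s = some s') (hi : P[s.pc]? = some i) : step W P s = some s' := by
  unfold step
  rw [hi]
  cases i <;> simp_all [Instr.exec]

theorem Instr.pc_of_exec {W : ℕ} {i : Instr} {s s' : Config} (h : i.exec W s = some s') :
    s'.pc = s.pc + 1 := by
  cases i <;> simp [Instr.exec, Config.write] at h <;> grind

/-- The effect of a list of instructions that are not jumps. -/
def exec (W : ℕ) : List Instr → Config → Option Config
  | [], s => some s
  | i :: B, s => (i.exec W s).bind (exec W B)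

theorem exec_append (W : ℕ) (A B : List Instr) (s : Config) :
    exec W (A ++ B) s = (exec W A s).bind (exec W B) := by
  induction A generalizing s with
  | nil => rfl
  | cons i A ih =>
    simp only [List.cons_append, exec, Option.bind_assoc]
    congr 1
    funext x
    exact ih x

theorem exec_trans {W : ℕ} {A B : List Instr} {s s' s'' : Config} (h : exec W A s = some s')
    (h' : exec W B s' = some s'') : exec W (A ++ B) s = some s'' := by
  rw [exec_append, h, Option.bind_some, h']

/-- Straight-line code can be analysed apart from the program that contains it, at one step per
instruction. -/
theorem run_of_exec {W : ℕ} {P : Program} {B : List Instr} {s s' : Config}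
    (h : exec W B s = some s') (hP : HasCode P s.pc B) : run W P B.length s = some s' := by
  induction B generalizing s with
  | nil => exact h
  | cons i B ih =>
    simp only [exec, Option.bind_eq_some_iff] at h
    obtain ⟨s₁, h₁, h₂⟩ := h
    rw [List.length_cons, run, Instr.step_of_exec h₁ hP.head, Option.bind_some]
    refine ih h₂ ?_
    rw [Instr.pc_of_exec h₁]
    exact hP.tail

/-! ### Counted loops -/

/-- The registers that control a loop: register `2` counts up to the bound in register `1`;
registers `0` and `8` hold `n` and `1`, and the registers from `9` on are not in use. -/
structure LoopRegs (n N a : ℕ) (r : ℕ → ℕ) : Prop where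
  n_eq : r 0 = n
  bound_eq : r 1 = N
  counter_eq : r 2 = a
  one_eq : r 8 = 1
  unused : ∀ i, 9 ≤ i → r i = 0

/-- At position `p`: execute `B` for each value of register `2` from `0` up to the bound in
register `1`. -/
def loop (p : ℕ) (B : List Instr) : List Instr :=
  .const 2 0 :: .jumpEq 2 1 (p + B.length + 4) :: (B ++ [.op .add 2 2 8, .jump (p + 1)])

theorem length_loop (p : ℕ) (B : List Instr) : (loop p B).length = B.length + 4 := by
  simp [loop]

/-- The code `B` takes memory `m` to memory `m'` when the counter of the loop is `a`. -/
def BodySpec (W n N : ℕ) (B : List Instr) (a : ℕ) (m m' : ℕ → ℕ) : Prop :=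
  ∀ p r, LoopRegs n N a r → ∃ r', LoopRegs n N a r' ∧
    exec W B ⟨p, r, m⟩ = some ⟨p + B.length, r', m'⟩

/-- Induction on the number `d` of remaining rounds. A round costs the body plus three steps (test,
increment, jump back); the final `1` is the test that exits. -/
theorem run_loop_from {W n N p : ℕ} {P : Program} {B : List Instr} {M : ℕ → ℕ → ℕ}
    (hP : HasCode P p (loop p B)) (hN : N < 2 ^ W)
    (hB : ∀ a < N, BodySpec W n N B a (M a) (M (a + 1))) (d : ℕ) :
    ∀ a r, a + d = N → LoopRegs n N a r → ∃ r', LoopRegs n N N r' ∧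
      run W P (d * (B.length + 3) + 1) ⟨p + 1, r, M a⟩ = some ⟨p + B.length + 4, r', M N⟩ := by
  have hj := hP.tail.head
  induction d with
  | zero =>
    rintro a r rfl hr
    refine ⟨r, hr, ?_⟩
    have e1 := hr.counter_eq
    have e2 := hr.bound_eq
    simp_all [run, step]
  | succ d ih =>
    intro a r had hr
    obtain ⟨r₁, hr₁, h₁⟩ := hB a (by omega) (p + 2) r hr
    have hc₁ := hP.tail.tail.left
    have hc₂ := hP.tail.tail.right
    have s0 : run W P 1 ⟨p + 1, r, M a⟩ = some ⟨p + 2, r, M a⟩ := by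
      have e1 := hr.counter_eq
      have e2 := hr.bound_eq
      rw [run_one]
      simp only [step, hj]
      rw [if_neg (by omega)]
    have s1 := run_of_exec h₁ hc₁
    have s2 : run W P 2 ⟨p + 2 + B.length, r₁, M (a + 1)⟩ =
        some ⟨p + 1, Function.update r₁ 2 (a + 1), M (a + 1)⟩ := by
      have i1 : P[p + 2 + B.length]? = _ := hc₂.head
      have i2 : P[p + 2 + B.length + 1]? = _ := hc₂.tail.head
      have e1 := hr₁.counter_eq
      have e2 := hr₁.one_eq
      have hlt : a + 1 < 2 ^ W := by omega
      simp [run, step, i1, i2, Config.write, BinOp.eval, e1, e2, hlt]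
    have hr₂ : LoopRegs n N (a + 1) (Function.update r₁ 2 (a + 1)) := by
      refine ⟨?_, ?_, ?_, ?_, fun i hi => ?_⟩
      · simp [hr₁.n_eq]
      · simp [hr₁.bound_eq]
      · simp
      · simp [hr₁.one_eq]
      · rw [Function.update_of_ne (by omega), hr₁.unused i hi]
    obtain ⟨r', hr', h'⟩ := ih (a + 1) _ (by omega) hr₂
    refine ⟨r', hr', ?_⟩
    have := run_trans (run_trans s0 (run_trans s1 s2)) h'
    rw [← this]
    congr 1
    ring

theorem run_loop {W n N p b : ℕ} {P : Program} {B : List Instr} {M : ℕ → ℕ → ℕ} {r : ℕ → ℕ}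
    (hP : HasCode P p (loop p B)) (hN : N < 2 ^ W)
    (hB : ∀ a < N, BodySpec W n N B a (M a) (M (a + 1))) (hr : LoopRegs n N b r) :
    ∃ r', LoopRegs n N N r' ∧ run W P (N * (B.length + 3) + 2) ⟨p, r, M 0⟩ =
      some ⟨p + (loop p B).length, r', M N⟩ := by
  have hr₁ : LoopRegs n N 0 (Function.update r 2 0) := by
    refine ⟨?_, ?_, ?_, ?_, fun i hi => ?_⟩
    · simp [hr.n_eq]
    · simp [hr.bound_eq]
    · simp
    · simp [hr.one_eq]
    · rw [Function.update_of_ne (by omega), hr.unused i hi]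
  obtain ⟨r', hr', h'⟩ := run_loop_from hP hN hB N 0 _ (by omega) hr₁
  refine ⟨r', hr', ?_⟩
  have s0 : run W P 1 ⟨p, r, M 0⟩ = some ⟨p + 1, Function.update r 2 0, M 0⟩ := by
    rw [run_one]
    have h0 : 0 < 2 ^ W := by omega
    simp [step, hP.head, Config.write]
  have := run_trans s0 h'
  rw [length_loop, ← add_assoc, ← this]
  congr 1
  ring

/-! ### Relocation -/

/-- An instruction, in a program that is moved by `q` positions. -/
def Instr.shift (q : ℕ) : Instr → Instr
  | .jump l => .jump (q + l)
  | .jumpLt a b l => .jumpLt a b (q + l)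
  | .jumpEq a b l => .jumpEq a b (q + l)
  | i => i

/-- The word length matters only for faults, so wider words leave a fault-free run unchanged. -/
theorem Config.write_shift {W W' : ℕ} (hW : W ≤ W') (q : ℕ) {s s' : Config} {d x : ℕ}
    (h : s.write W d x = some s') :
    (⟨q + s.pc, s.reg, s.mem⟩ : Config).write W' d x = some ⟨q + s'.pc, s'.reg, s'.mem⟩ := by
  unfold Config.write at h ⊢
  split_ifs at h with hx
  rw [if_pos (hx.trans_le (Nat.pow_le_pow_right two_pos hW))]
  cases h
  rfl

theorem getElem?_shift (A P : Program) (i : ℕ) :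
    (A ++ P.map (Instr.shift A.length))[A.length + i]? = P[i]?.map (Instr.shift A.length) := by
  rw [List.getElem?_append_right (by omega), Nat.add_sub_cancel_left, List.getElem?_map]

theorem step_shift {W W' : ℕ} (hW : W ≤ W') (A : Program) {P : Program} {s s' : Config}
    (h : step W P s = some s') :
    step W' (A ++ P.map (Instr.shift A.length)) ⟨A.length + s.pc, s.reg, s.mem⟩ =
      some ⟨A.length + s'.pc, s'.reg, s'.mem⟩ := by
  unfold step at h ⊢
  simp only [getElem?_shift]
  cases hi : P[s.pc]? with
  | none => simp [hi] at h
  | some i =>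
    rw [hi] at h
    cases i with
    | const d x => exact Config.write_shift hW _ h
    | op o d a b => exact Config.write_shift hW _ h
    | load d a => exact Config.write_shift hW _ h
    | store a r => cases h; rfl
    | jump l => cases h; rfl
    | jumpLt a b l =>
      cases h
      simp only [Option.map_some, Instr.shift]
      split_ifs <;> rfl
    | jumpEq a b l =>
      cases h
      simp only [Option.map_some, Instr.shift]
      split_ifs <;> rfl
    | halt => cases h

theorem run_shift {W W' : ℕ} (hW : W ≤ W') (A : Program) {P : Program} {t : ℕ} {s s' : Config}
    (h : run W P t s = some s') :
    run W' (A ++ P.map (Instr.shift A.length)) t ⟨A.length + s.pc, s.reg, s.mem⟩ =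
      some ⟨A.length + s'.pc, s'.reg, s'.mem⟩ := by
  induction t generalizing s with
  | zero => cases h; rfl
  | succ t ih =>
    simp only [run, Option.bind_eq_some_iff] at h
    obtain ⟨s₁, h₁, h₂⟩ := h
    rw [run, step_shift hW A h₁, Option.bind_some, ih h₂]

/-- Preprocessing that ends in the start configuration of `P`, followed by `P`. -/
theorem HaltsIn.append {W W' : ℕ} (hW : W ≤ W') {A P : Program} {t t' : ℕ} {s₀ s s' : Config}
    (hA : run W' (A ++ P.map (Instr.shift A.length)) t' s₀ =
      some ⟨A.length + s.pc, s.reg, s.mem⟩) (h : HaltsIn W P s t s') :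
    HaltsIn W' (A ++ P.map (Instr.shift A.length)) s₀ (t' + t)
      ⟨A.length + s'.pc, s'.reg, s'.mem⟩ := by
  refine ⟨run_trans hA (run_shift hW A h.1), ?_⟩
  simp only [getElem?_shift, h.2, Option.map_some, Instr.shift]

/-! ### Cells that are never read -/

/-- A run of `t` steps depends on at most `t` cells of the memory. -/
theorem exists_cells_read {W : ℕ} {P : Program} {t : ℕ} {s s' : Config}
    (h : run W P t s = some s') : ∃ A : Finset ℕ, A.card ≤ t ∧
      ∀ m : ℕ → ℕ, (∀ a ∈ A, m a = s.mem a) →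
        ∃ m', run W P t ⟨s.pc, s.reg, m⟩ = some ⟨s'.pc, s'.reg, m'⟩ := by
  classical
  induction t generalizing s with
  | zero => cases h; exact ⟨∅, by simp, fun m _ => ⟨m, rfl⟩⟩
  | succ t ih =>
    simp only [run, Option.bind_eq_some_iff] at h
    obtain ⟨s₁, h₁, h₂⟩ := h
    obtain ⟨A, hA, hm⟩ := ih h₂
    -- Only a load depends on memory, and on one cell; otherwise `0` serves as a dummy address. A
    -- store writes the same value to the same address in both memories, so agreement on `A`
    -- persists.
    have key : ∃ a : ℕ, ∀ m : ℕ → ℕ, m a = s.mem a → (∀ b ∈ A, m b = s.mem b) →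
        ∃ m₁, step W P ⟨s.pc, s.reg, m⟩ = some ⟨s₁.pc, s₁.reg, m₁⟩ ∧
          ∀ b ∈ A, m₁ b = s₁.mem b := by
      unfold step at h₁ ⊢
      cases hi : P[s.pc]? with
      | none => simp [hi] at h₁
      | some i =>
        simp only [hi] at h₁ ⊢
        cases i with
        | const d x =>
          refine ⟨0, fun m _ hmA => ⟨m, ?_⟩⟩
          simp only [Config.write] at h₁ ⊢
          split_ifs at h₁ ⊢
          cases h₁
          exact ⟨rfl, hmA⟩
        | op o d a b =>
          refine ⟨0, fun m _ hmA => ⟨m, ?_⟩⟩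
          simp only [Config.write] at h₁ ⊢
          split_ifs at h₁ ⊢
          cases h₁
          exact ⟨rfl, hmA⟩
        | load d a =>
          refine ⟨s.reg a, fun m hma hmA => ⟨m, ?_⟩⟩
          simp only [Config.write, hma] at h₁ ⊢
          split_ifs at h₁ ⊢
          cases h₁
          exact ⟨rfl, hmA⟩
        | store a r =>
          cases h₁
          refine ⟨0, fun m _ hmA => ⟨Function.update m (s.reg a) (s.reg r), rfl, ?_⟩⟩
          intro b hb
          simp only [Function.update_apply]
          split_ifs
          · rfl
          · exact hmA b hb
        | jump l => cases h₁; exact ⟨0, fun m _ hmA => ⟨m, rfl, hmA⟩⟩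
        | jumpLt a b l => cases h₁; exact ⟨0, fun m _ hmA => ⟨m, rfl, hmA⟩⟩
        | jumpEq a b l => cases h₁; exact ⟨0, fun m _ hmA => ⟨m, rfl, hmA⟩⟩
        | halt => cases h₁
    obtain ⟨a, ha⟩ := key
    refine ⟨insert a A, (Finset.card_insert_le _ _).trans (by omega), fun m hmA => ?_⟩
    obtain ⟨m₁, hs, hm₁⟩ := ha m (hmA a (by simp)) (fun b hb => hmA b (by simp [hb]))
    obtain ⟨m', hm'⟩ := hm m₁ hm₁
    exact ⟨m', by rw [run, hs, Option.bind_some, hm']⟩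

/-- No step can be performed at a `halt`, so neither run can extend the other. -/
theorem HaltsIn.unique {W : ℕ} {P : Program} {s s₁ s₂ : Config} {t₁ t₂ : ℕ}
    (h₁ : HaltsIn W P s t₁ s₁) (h₂ : HaltsIn W P s t₂ s₂) : s₁ = s₂ := by
  wlog hle : t₁ ≤ t₂ generalizing s₁ s₂ t₁ t₂
  · exact (this h₂ h₁ (by omega)).symm
  obtain ⟨d, rfl⟩ := Nat.exists_eq_add_of_le hle
  have h := h₂.1
  rw [run_add, h₁.1, Option.bind_some] at h
  cases d with
  | zero => exact Option.some.inj h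
  | succ d => simp [run, step, h₁.2] at h

end WordRAM

/-! ### Computing the adjacency tensor of the hypergraph of cliques -/

namespace WordRAM

open UniformHypergraph

theorem exec_const {W p d x : ℕ} {r m : ℕ → ℕ} {B : List Instr} (h : x < 2 ^ W) :
    exec W (.const d x :: B) ⟨p, r, m⟩ = exec W B ⟨p + 1, Function.update r d x, m⟩ := by
  simp [exec, Instr.exec, Config.write, h]

theorem exec_op {W p d a b : ℕ} {o : BinOp} {r m : ℕ → ℕ} {B : List Instr} (x : ℕ)
    (hx : o.eval (r a) (r b) = x) (h : x < 2 ^ W) :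
    exec W (.op o d a b :: B) ⟨p, r, m⟩ = exec W B ⟨p + 1, Function.update r d x, m⟩ := by
  simp [exec, Instr.exec, Config.write, h, hx]

theorem exec_load {W p d a : ℕ} {r m : ℕ → ℕ} {B : List Instr} (h : m (r a) < 2 ^ W) :
    exec W (.load d a :: B) ⟨p, r, m⟩ =
      exec W B ⟨p + 1, Function.update r d (m (r a)), m⟩ := by
  simp [exec, Instr.exec, Config.write, h]

theorem exec_store {W p a b : ℕ} {r m : ℕ → ℕ} {B : List Instr} :
    exec W (.store a b :: B) ⟨p, r, m⟩ =
      exec W B ⟨p + 1, r, Function.update m (r a) (r b)⟩ := by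
  simp [exec, Instr.exec]

/-- Registers `3` to `7` are scratch space for loop bodies. -/
theorem LoopRegs.update {n N a i : ℕ} {r : ℕ → ℕ} (h : LoopRegs n N a r) (h3 : 3 ≤ i) (h7 : i ≤ 7)
    (x : ℕ) : LoopRegs n N a (Function.update r i x) := by
  refine ⟨?_, ?_, ?_, ?_, fun j hj => ?_⟩
  · rw [Function.update_of_ne (by omega), h.n_eq]
  · rw [Function.update_of_ne (by omega), h.bound_eq]
  · rw [Function.update_of_ne (by omega), h.counter_eq]
  · rw [Function.update_of_ne (by omega), h.one_eq]
  · rw [Function.update_of_ne (by omega), h.unused j hj]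

/-- Copy cell `a` to cell `a + N`. -/
def copyBody : List Instr := [.op .add 3 2 1, .load 4 2, .store 3 4]

theorem copyBody_spec {W n N a : ℕ} {m : ℕ → ℕ} (h : a + N < 2 ^ W) (hm : m a < 2 ^ W) :
    BodySpec W n N copyBody a m (Function.update m (a + N) (m a)) := by
  intro p r hr
  have e1 := hr.counter_eq
  have e2 := hr.bound_eq
  refine ⟨Function.update (Function.update r 3 (a + N)) 4 (m a),
    (hr.update (by norm_num) (by norm_num) _).update (by norm_num) (by norm_num) _, ?_⟩
  rw [copyBody, exec_op (a + N) (by simp [BinOp.eval, e1, e2]) h, exec_load (by simpa [e1]), exec_store]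
  simp [exec, e1]

/-- Clear cell `a + N`. -/
def clearBody : List Instr := [.op .add 3 2 1, .const 4 0, .store 3 4]

theorem clearBody_spec {W n N a : ℕ} {m : ℕ → ℕ} (h : a + N < 2 ^ W) :
    BodySpec W n N clearBody a m (Function.update m (a + N) 0) := by
  intro p r hr
  have e1 := hr.counter_eq
  have e2 := hr.bound_eq
  refine ⟨Function.update (Function.update r 3 (a + N)) 4 0,
    (hr.update (by norm_num) (by norm_num) _).update (by norm_num) (by norm_num) _, ?_⟩
  rw [clearBody, exec_op (a + N) (by simp [BinOp.eval, e1, e2]) h, exec_const (by omega), exec_store]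
  simp [exec]

/-- Put the `i`-th base `n` digit of register `2` into register `d`. -/
def digitCode (d i : ℕ) : List Instr :=
  .const d 0 :: .op .add d d 2 :: (List.replicate i (.op .div d d 0) ++ [.op .mod d d 0])

theorem exec_replicate_div {W n d : ℕ} (hd : d ≠ 0) {m : ℕ → ℕ} (i : ℕ) :
    ∀ (p : ℕ) (r : ℕ → ℕ), r 0 = n → r d < 2 ^ W →
      exec W (List.replicate i (.op .div d d 0)) ⟨p, r, m⟩ =
        some ⟨p + i, Function.update r d (r d / n ^ i), m⟩ := by
  induction i with
  | zero => intro p r _ _; simp [exec]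
  | succ i ih =>
    intro p r hn hr
    have hlt : r d / n < 2 ^ W := (Nat.div_le_self _ _).trans_lt hr
    rw [List.replicate_succ, exec_op (r d / n) (by simp [BinOp.eval, hn]) hlt,
      ih _ _ (by rw [Function.update_of_ne hd.symm, hn]) (by simpa)]
    simp [Nat.div_div_eq_div_mul, ← pow_succ', add_assoc, add_comm 1 i]

theorem exec_digitCode {W n N a d p : ℕ} {r m : ℕ → ℕ} {B : List Instr} (i : ℕ)
    (hr : LoopRegs n N a r) (h3 : 3 ≤ d) (ha : a < 2 ^ W) :
    exec W (digitCode d i ++ B) ⟨p, r, m⟩ =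
      exec W B ⟨p + (digitCode d i).length, Function.update r d (digit n a i), m⟩ := by
  have e0 := hr.n_eq
  have e2 := hr.counter_eq
  have h0 : 0 ≠ d := by omega
  have h2 : 2 ≠ d := by omega
  have hlt : a / n ^ i % n < 2 ^ W :=
    (Nat.mod_le _ _).trans_lt ((Nat.div_le_self _ _).trans_lt ha)
  rw [exec_append, digitCode, exec_const (by omega),
    exec_op a (by simp [BinOp.eval, h2, e2]) ha, exec_append,
    exec_replicate_div h0.symm (n := n) i _ _ (by simp [h0, e0]) (by simpa), Option.bind_some,
    exec_op (a / n ^ i % n) (by simp [BinOp.eval, h0, e0]) hlt]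
  simp [exec, digit]
  congr 2
  omega

/-- Multiply register `5` by the entry of the tensor at `N` for the subtuple at positions `t`. -/
def tripleCode (t : ℕ × ℕ × ℕ) : List Instr :=
  digitCode 6 t.2.2 ++ (.op .mul 6 6 0 :: (digitCode 7 t.2.1 ++
    (.op .add 6 6 7 :: .op .mul 6 6 0 :: (digitCode 7 t.1 ++
      [.op .add 6 6 7, .op .add 6 6 1, .load 6 6, .op .mul 5 5 6]))))

/-- The address is evaluated by Horner's rule. It stays below `n ^ 3 ≤ N`, so adding the offset `N`
still gives a value that fits in a word. -/
theorem exec_tripleCode {W n N a p : ℕ} {r m : ℕ → ℕ} (t : ℕ × ℕ × ℕ) (hr : LoopRegs n N a r)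
    (ha : a < N) (hn : 0 < n) (hN : n ^ 3 ≤ N) (hW : N + N < 2 ^ W)
    (h5 : r 5 * m (subaddress n a t + N) < 2 ^ W) (hm : m (subaddress n a t + N) < 2 ^ W) :
    ∃ r', LoopRegs n N a r' ∧ r' 5 = r 5 * m (subaddress n a t + N) ∧
      exec W (tripleCode t) ⟨p, r, m⟩ = some ⟨p + (tripleCode t).length, r', m⟩ := by
  obtain ⟨i, j, l⟩ := t
  have hs := subaddress_lt (a := a) hn (i, j, l)
  have haW : a < 2 ^ W := by omega
  have e0 := hr.n_eq
  have e1 := hr.bound_eq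
  rw [tripleCode, exec_digitCode l hr (by norm_num) haW]
  simp only [subaddress] at hs h5 hm ⊢
  have r1 := hr.update (i := 6) (by norm_num) (by norm_num) (digit n a l)
  generalize digit n a l = z at *
  have r2 := r1.update (i := 6) (by norm_num) (by norm_num) (z * n)
  -- As `0 < n`, the intermediate Horner values are bounded by the final address.
  have b1 : z * n + digit n a j ≤ (z * n + digit n a j) * n := Nat.le_mul_of_pos_right _ hn
  rw [exec_op (z * n) (by simp [BinOp.eval, e0]) (by omega),
    exec_digitCode j r2 (by norm_num) haW]
  have r3 := r2.update (i := 7) (by norm_num) (by norm_num) (digit n a j)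
  generalize digit n a j = y at *
  have r4 := r3.update (i := 6) (by norm_num) (by norm_num) (z * n + y)
  have r5 := r4.update (i := 6) (by norm_num) (by norm_num) ((z * n + y) * n)
  rw [exec_op (z * n + y) (by simp [BinOp.eval]) (by omega),
    exec_op ((z * n + y) * n) (by simp [BinOp.eval, e0]) (by omega),
    exec_digitCode i r5 (by norm_num) haW]
  have r6 := r5.update (i := 7) (by norm_num) (by norm_num) (digit n a i)
  generalize digit n a i = x at *
  generalize hc : (z * n + y) * n + x = c at *
  have r7 := r6.update (i := 6) (by norm_num) (by norm_num) c
  have r8 := r7.update (i := 6) (by norm_num) (by norm_num) (c + N)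
  have r9 := r8.update (i := 6) (by norm_num) (by norm_num) (m (c + N))
  have r10 := r9.update (i := 5) (by norm_num) (by norm_num) (r 5 * m (c + N))
  refine ⟨_, r10, by simp, ?_⟩
  rw [exec_op c (by simp [BinOp.eval, hc]) (by omega),
    exec_op (c + N) (by simp [BinOp.eval, e1]) (by omega), exec_load (by simpa),
    exec_op (r 5 * m (c + N)) (by simp [BinOp.eval]) h5]
  simp [exec, -Function.update_idem]
  omega

/-- Replace cell `a` by the product of the entries of the tensor at `N` for all the increasing
triples of positions in the tuple at `a`. -/
noncomputable def cliqueBody (u : ℕ) : List Instr :=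
  .const 5 1 :: ((triples u).flatMap tripleCode ++ [.store 2 5])

theorem exec_flatMap_tripleCode {W n N a : ℕ} {m : ℕ → ℕ}
    (ha : a < N) (hn : 0 < n) (hN : n ^ 3 ≤ N) (hW : N + N < 2 ^ W) (hm : ∀ x, m x ≤ 1)
    (L : List (ℕ × ℕ × ℕ)) :
    ∀ (p : ℕ) (r : ℕ → ℕ), LoopRegs n N a r → r 5 ≤ 1 → ∃ r', LoopRegs n N a r' ∧
      r' 5 = r 5 * (L.map fun t => m (subaddress n a t + N)).prod ∧
      exec W (L.flatMap tripleCode) ⟨p, r, m⟩ =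
        some ⟨p + (L.flatMap tripleCode).length, r', m⟩ := by
  induction L with
  | nil => intro p r hr _; exact ⟨r, hr, by simp, rfl⟩
  | cons t L ih =>
    intro p r hr h5
    have h5m : r 5 * m (subaddress n a t + N) ≤ 1 := Nat.mul_le_mul h5 (hm _)
    have hmt := hm (subaddress n a t + N)
    obtain ⟨r₁, hr₁, h5₁, he₁⟩ := exec_tripleCode (p := p) (m := m) t hr ha hn hN hW (by omega) (by omega)
    obtain ⟨r₂, hr₂, h5₂, he₂⟩ := ih (p + (tripleCode t).length) r₁ hr₁ (by omega)
    refine ⟨r₂, hr₂, ?_, ?_⟩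
    · rw [h5₂, h5₁, List.map_cons, List.prod_cons, mul_assoc]
    · rw [List.flatMap_cons, exec_trans he₁ he₂, List.length_append, add_assoc]

theorem cliqueBody_spec {W n N a u : ℕ} {m : ℕ → ℕ}
    (ha : a < N) (hn : 0 < n) (hN : n ^ 3 ≤ N) (hW : N + N < 2 ^ W) (hm : ∀ x, m x ≤ 1) :
    BodySpec W n N (cliqueBody u) a m
      (Function.update m a ((triples u).map fun t => m (subaddress n a t + N)).prod) := by
  intro p r hr
  obtain ⟨r', hr', h5, he⟩ := exec_flatMap_tripleCode ha hn hN hW hm (triples u) (p + 1) _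
    (hr.update (i := 5) (by norm_num) (by norm_num) 1) (by simp)
  refine ⟨r', hr', ?_⟩
  rw [cliqueBody, exec_const (by omega), exec_append, he, Option.bind_some, exec_store]
  rw [Function.update_self, one_mul] at h5
  simp only [exec, hr'.counter_eq, h5, List.length_cons, List.length_append, List.length_nil]
  congr 2
  omega

/-- Put `n ^ u` into register `1` and `1` into register `8`. -/
def setup (u : ℕ) : List Instr :=
  .const 1 1 :: (List.replicate u (.op .mul 1 1 0) ++ [.const 8 1])

theorem exec_replicate_mul {W n : ℕ} {m : ℕ → ℕ} (i : ℕ) :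
    ∀ (p x : ℕ) (r : ℕ → ℕ), r 0 = n → r 1 = x → (∀ j ≤ i, x * n ^ j < 2 ^ W) →
      exec W (List.replicate i (.op .mul 1 1 0)) ⟨p, r, m⟩ =
        some ⟨p + i, Function.update r 1 (x * n ^ i), m⟩ := by
  induction i with
  | zero => rintro p x r _ rfl _; simp [exec]
  | succ i ih =>
    intro p x r hn hx h
    have h1 := h 1 (by omega)
    rw [pow_one] at h1
    rw [List.replicate_succ, exec_op (x * n) (by simp [BinOp.eval, hn, hx]) h1,
      ih _ (x * n) _ (by simpa) (by simp) fun j hj => ?_]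
    · simp only [Function.update_idem, add_assoc, add_comm 1 i, pow_succ', mul_assoc]
    · rw [mul_assoc, ← pow_succ']
      exact h _ (by omega)

theorem HasCode.right_zero {P : Program} {A B : List Instr} (h : HasCode P 0 (A ++ B)) :
    HasCode P A.length B := by
  simpa only [Nat.zero_add] using h.right

theorem exec_setup {W n u : ℕ} (hW : n ^ u + 1 < 2 ^ W) (m : ℕ → ℕ) :
    ∃ r, LoopRegs n (n ^ u) 0 r ∧
      exec W (setup u) ⟨0, fun r => if r = 0 then n else 0, m⟩ =
        some ⟨(setup u).length, r, m⟩ := by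
  have hpow : ∀ j ≤ u, 1 * n ^ j < 2 ^ W := by
    intro j hj
    have h1 : 1 < 2 ^ W := by omega
    rw [one_mul]
    -- For `n = 0` the powers are not monotone in the exponent: `0 ^ 0 = 1` may exceed `0 ^ u`.
    rcases Nat.eq_zero_or_pos n with rfl | hn
    · exact (pow_le_one₀ (Nat.zero_le 0) (Nat.zero_le 1)).trans_lt h1
    · exact (Nat.pow_le_pow_right hn hj).trans_lt (by omega)
  refine ⟨Function.update (Function.update (Function.update (fun r => if r = 0 then n else 0) 1 1)
    1 (1 * n ^ u)) 8 1, ⟨by simp, by simp, by simp, by simp, fun i hi => ?_⟩, ?_⟩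
  · rw [Function.update_of_ne (by omega), Function.update_of_ne (by omega),
      Function.update_of_ne (by omega), if_neg (by omega)]
  · rw [setup, exec_const (by omega), exec_append,
      exec_replicate_mul u _ 1 _ (by simp) (by simp) hpow, Option.bind_some,
      exec_const (by omega)]
    simp [exec]
    omega

/-- Reset the registers `1, …, 8`. -/
def cleanup : List Instr :=
  [.const 1 0, .const 2 0, .const 3 0, .const 4 0, .const 5 0, .const 6 0, .const 7 0, .const 8 0]

theorem exec_cleanup {W n N a p : ℕ} {r m : ℕ → ℕ} (hr : LoopRegs n N a r) :
    exec W cleanup ⟨p, r, m⟩ =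
      some ⟨p + cleanup.length, fun r => if r = 0 then n else 0, m⟩ := by
  have h0 : 0 < 2 ^ W := by positivity
  have e0 := hr.n_eq
  simp only [cleanup, exec_const h0]
  simp only [exec, List.length_cons, List.length_nil]
  congr 2
  funext i
  by_cases hi : 9 ≤ i
  · simp only [Function.update_apply, hr.unused i hi]
    simp
    omega
  · interval_cases i <;> simp [e0]

theorem run_cleanup {W n N a p : ℕ} {P : Program} {r : ℕ → ℕ} (hP : HasCode P p cleanup)
    (hr : LoopRegs n N a r) (m : ℕ → ℕ) : run W P cleanup.length ⟨p, r, m⟩ =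
      some ⟨p + cleanup.length, fun r => if r = 0 then n else 0, m⟩ :=
  run_of_exec (exec_cleanup hr) hP

/-- Replace the adjacency tensor of a `3`-uniform hypergraph by the one of the hypergraph of its
`u`-hypercliques. -/
noncomputable def preprocess (u : ℕ) : List Instr :=
  let A₁ := setup u ++ loop (setup u).length copyBody
  let A₂ := A₁ ++ loop A₁.length (cliqueBody u)
  A₂ ++ loop A₂.length clearBody ++ cleanup

theorem tensor_le_one {u n : ℕ} (G : UniformHypergraph u n) (a : ℕ) : G.tensor a ≤ 1 := by
  unfold tensor
  split_ifs <;> omega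

/-- The number of steps that `preprocess u` takes on `n` vertices. -/
noncomputable def preprocessTime (u n : ℕ) : ℕ :=
  (setup u).length + (n ^ u * (copyBody.length + 3) + 2) +
    (n ^ u * ((cliqueBody u).length + 3) + 2) + (n ^ u * (clearBody.length + 3) + 2) +
    cleanup.length

theorem run_preprocess {W n u : ℕ} (hu : 3 ≤ u) (G : UniformHypergraph 3 n)
    (hW : n ^ u + n ^ u + 1 < 2 ^ W) (P : Program) :
    run W (preprocess u ++ P) (preprocessTime u n)
      G.startConfig =
      some ⟨(preprocess u).length, (G.cliqueHypergraph u).startConfig.reg,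
        (G.cliqueHypergraph u).startConfig.mem⟩ := by
  have hcode : HasCode (preprocess u ++ P) 0 (preprocess u) := List.prefix_append _ _
  generalize preprocess u ++ P = Q at hcode ⊢
  simp only [preprocess] at hcode ⊢
  unfold preprocessTime
  have hN3 : n ^ 3 ≤ n ^ u := by
    rcases Nat.eq_zero_or_pos n with rfl | hn
    · simp
    · exact Nat.pow_le_pow_right hn hu
  have hzero : ∀ a, n ^ u ≤ a → G.tensor a = 0 := fun a ha => tensor_of_le G (hN3.trans ha)
  generalize hN : n ^ u = N at *
  -- Memory after `a` rounds of the three loops. The products overwrite cells below `N`, where the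
  -- tensor of `G` lies, so they read from a copy in `[N, 2 * N)`, which is cleared afterwards
  -- because the new start configuration has zeros there.
  let M₁ : ℕ → ℕ → ℕ := fun a x => if N ≤ x ∧ x < N + a then G.tensor (x - N) else G.tensor x
  let M₂ : ℕ → ℕ → ℕ := fun a x => if x < a then (G.cliqueHypergraph u).tensor x else M₁ N x
  let M₃ : ℕ → ℕ → ℕ := fun a x => if N ≤ x ∧ x < N + a then 0 else M₂ N x
  have b₁ : ∀ a < N, BodySpec W n N copyBody a (M₁ a) (M₁ (a + 1)) := by
    intro a ha
    have hval : M₁ a a = G.tensor a := if_neg (by omega)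
    have hle := tensor_le_one G a
    convert copyBody_spec (m := M₁ a) (by omega : a + N < 2 ^ W) (by omega) using 1
    funext x
    rw [hval, Function.update_apply]
    split_ifs with hx
    · simp only [M₁, hx]
      rw [if_pos (by omega), Nat.add_sub_cancel]
    · simp only [M₁]
      congr 1
      apply propext
      omega
  have le₁ : ∀ x, M₁ N x ≤ 1 := by
    intro x
    simp only [M₁]
    split_ifs <;> exact tensor_le_one G _
  have b₂ : ∀ a < N, BodySpec W n N (cliqueBody u) a (M₂ a) (M₂ (a + 1)) := by
    intro a ha
    have hn : 0 < n := by
      rcases Nat.eq_zero_or_pos n with rfl | hn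
      · rw [zero_pow (by omega)] at hN; omega
      · exact hn
    have hval : ∀ t, M₂ a (subaddress n a t + N) = G.tensor (subaddress n a t) := by
      intro t
      have := subaddress_lt (a := a) hn t
      simp only [M₂, M₁]
      rw [if_neg (by omega), if_pos (by omega), Nat.add_sub_cancel]
    have le₂ : ∀ x, M₂ a x ≤ 1 := by
      intro x
      simp only [M₂]
      split_ifs
      · exact tensor_le_one _ _
      · exact le₁ x
    convert cliqueBody_spec (u := u) ha hn hN3 (by omega : N + N < 2 ^ W) le₂ using 1
    simp only [hval]
    rw [prod_tensor_subaddress G hu (by omega)]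
    funext x
    rw [Function.update_apply]
    split_ifs with hx
    · simp [M₂, hx]
    · simp only [M₂]
      congr 1
      apply propext
      omega
  have b₃ : ∀ a < N, BodySpec W n N clearBody a (M₃ a) (M₃ (a + 1)) := by
    intro a ha
    convert clearBody_spec (m := M₃ a) (by omega : a + N < 2 ^ W) using 1
    funext x
    rw [Function.update_apply]
    split_ifs with hx
    · simp only [M₃, hx]
      rw [if_pos (by omega)]
    · simp only [M₃]
      congr 1
      apply propext
      omega
  have m₀ : M₁ 0 = G.tensor := by
    funext x
    exact if_neg (by omega)
  have m₁ : M₂ 0 = M₁ N := by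
    funext x
    exact if_neg (by omega)
  have m₂ : M₃ 0 = M₂ N := by
    funext x
    exact if_neg (by omega)
  have m₃ : M₃ N = (G.cliqueHypergraph u).tensor := by
    funext x
    simp only [M₃, M₂, M₁]
    split_ifs with h1 h2
    · rw [tensor_of_le _ (by omega)]
    · rfl
    · rw [hzero x (by omega), tensor_of_le _ (by omega)]
  obtain ⟨r₀, hr₀, s₀⟩ := exec_setup (W := W) (n := n) (u := u) (by omega) G.tensor
  rw [hN] at hr₀
  obtain ⟨r₁, hr₁, s₁⟩ := run_loop hcode.left.left.left.right_zero (by omega) b₁ hr₀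
  obtain ⟨r₂, hr₂, s₂⟩ := run_loop hcode.left.left.right_zero (by omega) b₂ hr₁
  obtain ⟨r₃, hr₃, s₃⟩ := run_loop hcode.left.right_zero (by omega) b₃ hr₂
  have s₄ := run_cleanup (W := W) hcode.right_zero hr₃ (M₃ N)
  have h₀ := run_of_exec s₀ hcode.left.left.left.left
  rw [m₀, ← List.length_append] at s₁
  rw [m₁, ← List.length_append] at s₂
  rw [m₂, m₃, ← List.length_append] at s₃
  rw [m₃, ← List.length_append] at s₄
  exact run_trans (run_trans (run_trans (run_trans h₀ s₁) s₂) s₃) s₄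

end WordRAM

/-! ### The lower bounds -/

open UniformHypergraph WordRAM

theorem SolvesInTime.mono {u : ℕ} {R R' : HypergraphProblem u} {P : Program} {T : ℕ → ℕ}
    (h : ∀ n G out, R n G out → R' n G out) (hs : SolvesInTime R P T) : SolvesInTime R' P T := by
  obtain ⟨c, hc, hs⟩ := hs
  refine ⟨c, hc, fun n G => ?_⟩
  obtain ⟨t, ht, s, hh, hR⟩ := hs n G
  exact ⟨t, ht, s, hh, h _ _ _ hR⟩

theorem RequiresTimePow.mono {u k : ℕ} {R R' : HypergraphProblem u}
    (h : ∀ n G out, R n G out → R' n G out) (hr : RequiresTimePow R' k) :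
    RequiresTimePow R k := by
  rintro ε hε ⟨P, T, hT, hs⟩
  exact hr ε hε ⟨P, T, hT, hs.mono h⟩

/-- Preprocessing turns a program that detects hypercycles into one that detects hypercliques. -/
theorem SolvesInTime.detectHyperclique {u k : ℕ} {P : Program} {T : ℕ → ℕ} (hu : 3 ≤ u)
    (huk : u ≤ k) (h : 2 * k < 3 * u) (hs : SolvesInTime (detectHypercycle u k) P T) :
    SolvesInTime (detectHyperclique 3 k)
      (preprocess u ++ P.map (Instr.shift (preprocess u).length))
      (fun n => preprocessTime u n + T n) := by
  obtain ⟨c, hc, hs⟩ := hs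
  refine ⟨c + (u + 2), by omega, fun n G => ?_⟩
  obtain ⟨t, ht, s, hh, hR⟩ := hs n (G.cliqueHypergraph u)
  -- From `n < 2 ^ (Nat.log 2 n + 1)`; the two further bits absorb the doubling and the `+ 1`.
  have hW : n ^ u + n ^ u + 1 < 2 ^ ((c + (u + 2)) * (Nat.log 2 n + 1)) := by
    have h1 : n ^ u ≤ 2 ^ (u * (Nat.log 2 n + 1)) := by
      rw [mul_comm, pow_mul]
      exact Nat.pow_le_pow_left (Nat.lt_pow_succ_log_self (by norm_num) n).le u
    have h2 : 2 ^ (u * (Nat.log 2 n + 1) + 2) ≤ 2 ^ ((c + (u + 2)) * (Nat.log 2 n + 1)) :=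
      Nat.pow_le_pow_right two_pos (by nlinarith)
    have h3 : 0 < 2 ^ (u * (Nat.log 2 n + 1)) := by positivity
    rw [pow_add] at h2
    omega
  refine ⟨preprocessTime u n + t, by simpa using ht, _,
    HaltsIn.append (Nat.mul_le_mul_right _ (by omega)) (run_preprocess hu G hW _) hh, ?_⟩
  exact hR.trans (exists_isHypercycle_cliqueHypergraph_iff G huk h)

/-- The time is `O(n ^ u)`, and `u ≤ k - 1 ≤ k - δ`. -/
theorem preprocessTime_isBigO {u k : ℕ} (huk : u < k) {δ : ℝ} (hδ : δ ≤ 1) :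
    (fun n : ℕ => (preprocessTime u n : ℝ)) =O[atTop] fun n : ℕ => (n : ℝ) ^ ((k : ℝ) - δ) := by
  let C : ℕ := (setup u).length + (copyBody.length + 3) + ((cliqueBody u).length + 3) +
    (clearBody.length + 3) + 6 + cleanup.length
  refine IsBigO.of_bound (C : ℝ) ?_
  filter_upwards [eventually_ge_atTop 1] with n hn
  have h1 : preprocessTime u n ≤ C * n ^ u := by
    have : 1 ≤ n ^ u := Nat.one_le_pow _ _ hn
    simp only [preprocessTime, C]
    nlinarith [Nat.zero_le (setup u).length, Nat.zero_le cleanup.length]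
  have h2 : (n : ℝ) ^ u ≤ (n : ℝ) ^ ((k : ℝ) - δ) := by
    rw [← Real.rpow_natCast]
    apply Real.rpow_le_rpow_of_exponent_le (by exact_mod_cast hn)
    have : (u : ℝ) + 1 ≤ k := by exact_mod_cast huk
    linarith
  rw [Real.norm_of_nonneg (by positivity), Real.norm_of_nonneg (by positivity)]
  calc (preprocessTime u n : ℝ) ≤ C * (n : ℝ) ^ u := by exact_mod_cast h1
    _ ≤ _ := by gcongr

theorem requiresTimePow_detectHypercycle_of_lt {u k : ℕ} (hu : 3 ≤ u) (huk : u < k)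
    (h : 2 * k < 3 * u) (hyp : HypercliqueHypothesis 3 k) :
    RequiresTimePow (detectHypercycle u k) k := by
  rintro ε hε ⟨P, T, hT, hs⟩
  -- For `ε > 1` the preprocessing could dominate, so the saving is capped at `1`.
  refine hyp (min ε 1) (by positivity) ⟨_, _, ?_, hs.detectHyperclique hu huk.le h⟩
  simp only [Nat.cast_add]
  refine (preprocessTime_isBigO huk (min_le_right _ _)).add (hT.trans ?_)
  refine IsBigO.of_bound 1 ?_
  filter_upwards [eventually_ge_atTop 1] with n hn
  rw [Real.norm_of_nonneg (by positivity), Real.norm_of_nonneg (by positivity), one_mul]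
  apply Real.rpow_le_rpow_of_exponent_le (by exact_mod_cast hn)
  have := min_le_left ε 1
  linarith

/-- A program that detects a hypercycle on `k` vertices in a `k`-uniform hypergraph, which is just
a hyperedge, has to read a cell for each set of `k` vertices if there is none. -/
theorem SolvesInTime.choose_le {k : ℕ} (hk : 0 < k) {P : Program} {T : ℕ → ℕ}
    (hs : SolvesInTime (detectHypercycle k k) P T) (n : ℕ) : n.choose k ≤ T n := by
  classical
  obtain ⟨c, -, hs⟩ := hs
  let G₀ : UniformHypergraph k n := ⟨∅, by simp⟩
  obtain ⟨t, ht, s, ⟨hrun, hhalt⟩, hR⟩ := hs n G₀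
  obtain ⟨A, hA, hread⟩ := exists_cells_read hrun
  by_contra! hlt
  let f : ℕ → Finset (Fin n) := fun a =>
    if h : a < n ^ k then Finset.univ.image (tupleAt ⟨a, h⟩) else ∅
  -- Each cell read concerns one vertex set, so with fewer than `n.choose k` reads some `k`-set `e`
  -- is never examined. Adding `e` as the only hyperedge creates a hypercycle but leaves the output
  -- unchanged.
  obtain ⟨e, he, hef⟩ := Finset.exists_mem_notMem_of_card_lt_card
    (s := A.image f) (t := Finset.powersetCard k Finset.univ) (by
      rw [Finset.card_powersetCard, Finset.card_univ, Fintype.card_fin]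
      exact (Finset.card_image_le.trans hA).trans_lt (ht.trans_lt hlt))
  have hek : e.card = k := (Finset.mem_powersetCard.1 he).2
  let G₁ : UniformHypergraph k n := ⟨{e}, by simpa using hek⟩
  have hagree : ∀ a ∈ A, G₁.tensor a = G₀.tensor a := by
    intro a ha
    by_cases hak : a < n ^ k
    · have hne : Finset.univ.image (tupleAt ⟨a, hak⟩) ≠ e := by
        rintro hae
        refine hef (Finset.mem_image.2 ⟨a, ha, ?_⟩)
        simp only [f, dif_pos hak, hae]
      rw [tensor_of_lt _ hak, tensor_of_lt _ hak, if_neg (by simpa [G₁] using hne),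
        if_neg (by simp [G₀])]
    · rw [tensor_of_le _ (not_lt.1 hak), tensor_of_le _ (not_lt.1 hak)]
  obtain ⟨m', hm'⟩ := hread _ hagree
  obtain ⟨t₁, -, s₁, hh₁, hR₁⟩ := hs n G₁
  have hs₁ : s₁ = ⟨s.pc, s.reg, m'⟩ := hh₁.unique ⟨hm', hhalt⟩
  have hcycle : ∃ v, G₁.IsHypercycle k v := by
    refine ⟨e.orderEmbOfFin hek, (e.orderEmbOfFin hek).injective, fun i => ?_⟩
    refine Finset.mem_singleton.2 (Finset.eq_of_subset_of_card_le ?_ ?_)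
    · intro w hw
      obtain ⟨j, -, rfl⟩ := Finset.mem_image.1 hw
      exact e.orderEmbOfFin_mem hek _
    · rw [hek, card_window le_rfl (e.orderEmbOfFin hek).injective i]
  have hout := hR₁.2 hcycle
  rw [hs₁] at hout
  obtain ⟨v, -, hv⟩ := hR.1 hout
  exact absurd (hv ⟨0, hk⟩) (Finset.notMem_empty _)

/-- `n.choose k` has order `n ^ k`, which is not `O(n ^ (k - ε))`. -/
theorem requiresTimePow_detectHypercycle_self {k : ℕ} (hk : 0 < k) :
    RequiresTimePow (detectHypercycle k k) k := by
  rintro ε hε ⟨P, T, hT, hs⟩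
  have h1 : (fun n : ℕ => (n : ℝ) ^ k) =O[atTop] fun n : ℕ => (n : ℝ) ^ ((k : ℝ) - ε) := by
    refine ((isTheta_choose k).2.trans (IsBigO.of_bound 1 (Eventually.of_forall fun n => ?_))).trans
      hT
    rw [Real.norm_natCast, Real.norm_natCast, one_mul]
    exact_mod_cast hs.choose_le hk n
  have h2 : (fun n : ℕ => (n : ℝ) ^ ((k : ℝ) - ε)) =o[atTop] fun n : ℕ => (n : ℝ) ^ k := by
    rw [isLittleO_iff_tendsto']
    · refine ((tendsto_rpow_neg_atTop hε).comp tendsto_natCast_atTop_atTop).congr' ?_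
      filter_upwards [eventually_ge_atTop 1] with n hn
      have hn' : (0 : ℝ) < n := by exact_mod_cast hn
      rw [Function.comp_apply, ← Real.rpow_natCast, ← Real.rpow_sub hn']
      congr 1
      ring
    · filter_upwards [eventually_ge_atTop 1] with n hn h0
      have hn' : (0 : ℝ) < n := by exact_mod_cast hn
      exact absurd h0 (by positivity)
  refine isLittleO_irrefl ?_ (h1.trans_isLittleO h2)
  refine Eventually.frequently ?_
  filter_upwards [eventually_ge_atTop 1] with n hn
  have hn' : (0 : ℝ) < n := by exact_mod_cast hn
  positivity

/-- For `K = gammaInv 3 u`, `u = K - ⌈K / 3⌉ + 1 > 2 * K / 3`, and `k ≤ K`. -/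
theorem two_mul_lt_of_le_gammaInv {u k : ℕ} (hu : 0 < u) (hk : k ≤ gammaInv 3 u) :
    2 * k < 3 * u := by
  have h1 : gamma 3 (gammaInv 3 u) = u := (gammaInv_isGreatest u hu).1
  generalize gammaInv 3 u = K at *
  have h2 : ⌈(K : ℚ) / (3 : ℕ)⌉₊ ≤ (K + 2) / 3 := by
    rw [Nat.ceil_le, div_le_iff₀ (by norm_num)]
    have : K ≤ (K + 2) / 3 * 3 := by omega
    exact_mod_cast this
  unfold gamma at h1
  omega

theorem findHypercycle_detects {u k n : ℕ} {G : UniformHypergraph u n} {out : ℕ → ℕ}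
    (h : findHypercycle u k n G out) : detectHypercycle u k n G out := by
  rcases h with ⟨h0, v, hv, -⟩ | ⟨h0, hv⟩
  · exact ⟨fun _ => ⟨v, hv⟩, fun _ => h0⟩
  · exact ⟨fun h => absurd h0 h, fun h => absurd h hv⟩

theorem countHypercycles_detects {u k n : ℕ} {G : UniformHypergraph u n} {out : ℕ → ℕ}
    (h : countHypercycles u k n G out) : detectHypercycle u k n G out := by
  unfold detectHypercycle
  rw [countHypercycles] at h
  rw [h, Nat.card_ne_zero, nonempty_subtype]
  -- `Nat.card` is also `0` on infinite types, so finiteness of the set of hypercycles is needed.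
  exact and_iff_left inferInstance

theorem mainTheorem2 (u k : ℕ) (hu : 0 < u) (huk : u ≤ k) (hk : k ≤ gammaInv 3 u)
    (hyp : HypercliqueHypothesis 3 k) :
    RequiresTimePow (detectHypercycle u k) k ∧
      RequiresTimePow (findHypercycle u k) k ∧
      RequiresTimePow (countHypercycles u k) k := by
  have h := two_mul_lt_of_le_gammaInv hu hk
  have hdetect : RequiresTimePow (detectHypercycle u k) k := by
    rcases huk.eq_or_lt with rfl | hlt
    · exact requiresTimePow_detectHypercycle_self hu
    -- Here `u + 1 ≤ k` and `2 * k < 3 * u` force `3 ≤ u`.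
    · exact requiresTimePow_detectHypercycle_of_lt (by omega) hlt h hyp
  exact ⟨hdetect, hdetect.mono fun _ _ _ => findHypercycle_detects,
    hdetect.mono fun _ _ _ => countHypercycles_detects⟩
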